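/- **Setting.** For a natural number $n$, a ReLU network $f:\mathbb R^n\to\mathbb R$ is a function of the form $$f(x)=W_{\ell}\,\sigma\big(W_{\ell-1}\cdots\sigma(W_1x+b_1)\cdots+b_{\ell-1}\big)+b_{\ell},$$ where $\sigma(t)=\max\{0,t\}$ is applied componentwise. Its depth is $\ell\ge 1$, and its size is the number of nonzero entries of $W_1,\dots,W_\ell,b_1,\dots,b_\ell$. Let $\mathcal F_{NN}(n,n',L,r,M)$ be the class of maps $\Gamma=(f^{(1)},\dots,f^{(n')}):[-M,M]^n\to\mathbb R^{n'}$ each of whose components is a ReLU network of depth at most $L$ and size at most $r$. Let $H,Y$ be real separable Hilbert spaces with orthonormal sequences $(w_k)_{k\ge1}$ in $H$ and $(w'_k)_{k\ge1}$ in $Y$ (orthonormal bases, for example). For $d_H,d_Y\ge 1$ put $\mathcal E^{d_H}(x)=(\langle x,w_i\rangle)_{i\le d_H}$, $\mathcal D^{d_H}(a)=\sum_{i\le d_H}a_iw_i$, $\mathcal P^{d_Y}(y)=(\langle y,w'_i\rangle)_{i\le d_Y}$, $\mathcal R^{d_Y}(b)=\sum_{i\le d_Y}b_iw'_i$. Let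 $R>0$, let $\mathbb P$ be a Borel probability measure on $H$ with compact support contained in $B_R(H)=\{x\in H:\|x\|_H\le R\}$, and let $\Psi:H\to Y$ be Lipschitz with constant $L_\Psi$. Put $$\mathrm{Pr}=\mathbb E_{x\sim\mathbb P}\|x-\mathcal D^{d_H}\mathcal E^{d_H}x\|_H^2,\qquad \mathrm{Pr}^{\Psi_\sharp\mathbb P}=\mathbb E_{y\sim\Psi_\sharp\mathbb P}\|y-\mathcal R^{d_Y}\mathcal P^{d_Y}y\|_Y^2 .$$ **Lemma.** There are constants $c=c(d_H,d_Y,L_\Psi)>0$, depending only on $d_H,d_Y,L_\Psi$, such that the following holds. For all $H$, $Y$, $(w_k)$, $(w'_k)$, $R$, $\mathbb P$, $\Psi$, $L_\Psi$ as above there are $Q_H,Q_Y\ge 0$ such that for all $d_H,d_Y,N\ge1$ and every $\delta>0$ with $\delta\sqrt{d_H}<2R\sqrt{d_Y}$ there exist natural numbers $L,r$ and a map $\Gamma_{NN}:\mathbb R^{d_H}\to\mathbb R^{d_Y}$, each of whose components is, on all of $\mathbb R^{d_H}$, a ReLU network of depth at most $L$ and size at most $r$ (so the restriction of $\Gamma_{NN}$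 to $[-R/\sqrt{d_H},R/\sqrt{d_H}]^{d_H}$ is in $\mathcal F_{NN}(d_H,d_Y,L,r,R/\sqrt{d_H})$), with $$L\le c\Big[\log\Big(\frac{R\sqrt{d_Y}}{\delta\sqrt{d_H}}\Big)+1\Big],\qquad r\le c\Big(\frac{\delta\sqrt{d_H}}{2R}\Big)^{-d_H}\Big[\log\Big(\frac{R\sqrt{d_Y}}{\delta\sqrt{d_H}}\Big)+1\Big],$$ and $$\mathbb E_{x_1,\dots,x_N\sim\mathbb P}\,\mathbb E_{x\sim\mathbb P}\big\|\mathcal R^{d_Y}\circ\Gamma_{NN}\circ\mathcal E^{d_H}(x)-\Psi(x)\big\|_Y^2<2\delta^2+4L_\Psi^2\Big(\sqrt{\tfrac{Q_Hd_H}{N}}+\mathrm{Pr}\Big)+4\Big(\sqrt{\tfrac{Q_Yd_Y}{N}}+\mathrm{Pr}^{\Psi_\sharp\mathbb P}\Big),$$ where $x_1,\dots,x_N$ are i.i.d. with law $\mathbb P$. -/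

import Mathlib

open MeasureTheory
open scoped NNReal

noncomputable section

/-- A feedforward ReLU network `ℝⁿ → ℝ`,
`x ↦ W_L σ(W_{L-1} ⋯ σ(W₁ x + b₁) ⋯ + b_{L-1}) + b_L`, given by its weights and biases.
`output` is the last (affine) layer; `hidden` puts a layer `x ↦ σ(W x + b)` in front. -/
inductive ReLUNet : ℕ → Type
  | output {n : ℕ} (W : Fin n → ℝ) (b : ℝ) : ReLUNet n
  | hidden {n m : ℕ} (W : Matrix (Fin m) (Fin n) ℝ) (b : Fin m → ℝ) (f : ReLUNet m) : ReLUNet n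

namespace ReLUNet

/-- The function on `ℝⁿ` that the network computes. -/
def eval : {n : ℕ} → ReLUNet n → (Fin n → ℝ) → ℝ
  | _, output W b, x => W ⬝ᵥ x + b
  | _, hidden W b f, x => eval f (fun i => max 0 ((Matrix.mulVec W x) i + b i))

/-- The depth `L`: the number of affine layers `(W_i, b_i)`. -/
def depth : {n : ℕ} → ReLUNet n → ℕ
  | _, output _ _ => 1
  | _, hidden _ _ f => depth f + 1

/-- The number of (nonzero) weights and biases of the network. -/
def size : {n : ℕ} → ReLUNet n → ℕ
  | n, output W b => {j : Fin n | W j ≠ 0}.ncard + {_u : Unit | b ≠ 0}.ncard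
  | n, @hidden _ m W b f =>
      {p : Fin m × Fin n | W p.1 p.2 ≠ 0}.ncard + {i : Fin m | b i ≠ 0}.ncard + size f

end ReLUNet

/-- `Γ : ℝⁿ → ℝⁿ'` is a map each of whose components is computed, on all of `ℝⁿ`, by a ReLU network
of depth at most `L` with at most `r` weights and biases. -/
def IsReLUMap (n n' L r : ℕ)
    (Γ : EuclideanSpace ℝ (Fin n) → EuclideanSpace ℝ (Fin n')) : Prop :=
  ∀ k : Fin n', ∃ f : ReLUNet n, f.depth ≤ L ∧ f.size ≤ r ∧
    ∀ x : EuclideanSpace ℝ (Fin n), Γ x k = f.eval (fun i => x i)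

/-- The cube `[-M, M]ⁿ`. -/
def cube (n : ℕ) (M : ℝ) : Set (EuclideanSpace ℝ (Fin n)) :=
  {x | ∀ i, x i ∈ Set.Icc (-M) M}

/-- The network class `F_NN(n, n', L, r, M)` of maps `[-M, M]ⁿ → ℝⁿ'`. -/
def FNN (n n' L r : ℕ) (M : ℝ) : Set (cube n M → EuclideanSpace ℝ (Fin n')) :=
  {g | ∀ k : Fin n', ∃ f : ReLUNet n, f.depth ≤ L ∧ f.size ≤ r ∧
    ∀ x : cube n M, g x k = f.eval (fun i => x.1 i)}

section Encoders

variable {E : Type*} [NormedAddCommGroup E] [InnerProductSpace ℝ E]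

/-- The encoder `x ↦ (⟨x, w₁⟩, …, ⟨x, w_d⟩)`; the sequence `w` is indexed from `0`. -/
def encoder (w : ℕ → E) (d : ℕ) (x : E) : EuclideanSpace ℝ (Fin d) :=
  WithLp.toLp 2 (fun i : Fin d => inner ℝ x (w i))

/-- The decoder `a ↦ ∑ aᵢ wᵢ`. -/
def decoder (w : ℕ → E) (d : ℕ) (a : EuclideanSpace ℝ (Fin d)) : E :=
  ∑ i : Fin d, a i • w i

/-- The mean squared projection error `𝔼_{x ∼ μ} ‖x - Π_d x‖²`, where `Π_d` is the decoder after
the encoder. -/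
def projError [MeasurableSpace E] (w : ℕ → E) (d : ℕ) (μ : Measure E) : ℝ :=
  ∫ x, ‖x - decoder w d (encoder w d x)‖ ^ 2 ∂μ

end Encoders

end

/-! The encoders are fixed orthonormal coordinates, so nothing is learned from the sample and both
`Q` constants can be 0. Each coordinate of the encoded map is `LΨ`-Lipschitz for the ℓ¹ norm. Such a
`g` is recovered on a cube, up to twice `LΨ` times the mesh distance, by the maximum of the cones `g
p - LΨ ‖x - p‖₁` over a grid (`exists_isReLUComputable_near`). A tournament of pairwise maxima
computes it with depth linear in the log of the number of cones and size linear in that number.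
`exists_gridSize` picks the mesh. `norm_decoder_sub_sq_le` then adds the two projection errors. The
approximation cube is `[-R, R]^d`, which contains all encoded points; the smaller cube in the
statement is a mere restriction. -/

/-- A finite sparse matrix with at most `s` nonzero entries per row has at most `card κ * s` nonzero
entries. -/
theorem ncard_ne_zero_le {κ ι : Type*} [Finite ι] [Fintype κ] (W : κ → ι → ℝ) (s : ℕ)
    (hs : ∀ k, {i | W k i ≠ 0}.ncard ≤ s) :
    {p : κ × ι | W p.1 p.2 ≠ 0}.ncard ≤ Fintype.card κ * s := by
  classical
  have h : {p : κ × ι | W p.1 p.2 ≠ 0} =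
      ⋃ k ∈ (Finset.univ : Finset κ), (fun i => (k, i)) '' {i | W k i ≠ 0} := by
    ext ⟨k, i⟩
    simp
  rw [h]
  refine (Finset.set_ncard_biUnion_le _ _).trans ?_
  refine (Finset.sum_le_card_nsmul _ _ s fun k _ => ?_).trans (by simp)
  exact (Set.ncard_image_le (Set.toFinite _)).trans (hs k)

/-! ### Building networks layer by layer -/

/-- `F : ℝ^ι → ℝ` is computed by a ReLU network of depth at most `L` and size at most `r`, after
numbering the coordinates. -/
def IsReLUComputable {ι : Type*} [Fintype ι] (L r : ℕ) (F : (ι → ℝ) → ℝ) : Prop :=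
  ∀ e : ι ≃ Fin (Fintype.card ι), ∃ f : ReLUNet (Fintype.card ι), f.depth ≤ L ∧ f.size ≤ r ∧
    ∀ x : ι → ℝ, f.eval (x ∘ e.symm) = F x

namespace IsReLUComputable

variable {ι κ : Type*} [Fintype ι] [Fintype κ]

theorem mono {L r L' r' : ℕ} {F : (ι → ℝ) → ℝ} (h : IsReLUComputable L r F) (hL : L ≤ L')
    (hr : r ≤ r') : IsReLUComputable L' r' F := fun e => by
  obtain ⟨f, h1, h2, h3⟩ := h e
  exact ⟨f, h1.trans hL, h2.trans hr, h3⟩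

theorem output (W : ι → ℝ) (b : ℝ) :
    IsReLUComputable 1 (Fintype.card ι + 1) (fun x => ∑ i, W i * x i + b) := fun e => by
  refine ⟨.output (W ∘ e.symm) b, le_rfl, ?_, fun x => ?_⟩
  · refine Nat.add_le_add ((Set.ncard_le_card _).trans (by simp)) ((Set.ncard_le_card _).trans ?_)
    simp
  · simp only [ReLUNet.eval, dotProduct]
    rw [← Equiv.sum_comp e]
    simp

/-- Each new neuron costs at most `s` weights and one bias. Tracking row sparsity keeps the size
linear, not quadratic, in the width. -/
theorem hidden {L r : ℕ} {G : (κ → ℝ) → ℝ} (h : IsReLUComputable L r G) (W : κ → ι → ℝ)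
    (b : κ → ℝ) (s : ℕ) (hs : ∀ k, {i | W k i ≠ 0}.ncard ≤ s) :
    IsReLUComputable (L + 1) (r + Fintype.card κ * (s + 1))
      (fun x => G (fun k => max 0 (∑ i, W k i * x i + b k))) := fun e => by
  let eκ := Fintype.equivFin κ
  obtain ⟨f, h1, h2, h3⟩ := h eκ
  refine ⟨.hidden (.of fun k i => W (eκ.symm k) (e.symm i)) (b ∘ eκ.symm) f,
    Nat.succ_le_succ h1, ?_, fun x => ?_⟩
  · have hW := ncard_ne_zero_le (Matrix.of fun k i => W (eκ.symm k) (e.symm i)) s (fun k => by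
      refine le_trans (le_of_eq ?_) (hs (eκ.symm k))
      rw [← Set.ncard_image_of_injective _ e.symm.injective]
      congr 1
      ext i
      simp)
    have hb : {k | (b ∘ eκ.symm) k ≠ 0}.ncard ≤ Fintype.card κ :=
      (Set.ncard_le_card _).trans (by simp)
    rw [Fintype.card_fin] at hW
    simp only [ReLUNet.size]
    rw [Nat.mul_add, mul_one]
    omega
  · refine Eq.trans ?_ (h3 _)
    simp only [ReLUNet.eval]
    congr 1
    ext k
    simp only [Matrix.mulVec, dotProduct, Function.comp]
    rw [← Equiv.sum_comp e]
    simp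

end IsReLUComputable

/-! ### Maxima and cones -/

/-- The maximum of `2 ^ k` nonnegative numbers (shifted by `c`) is computed by a ReLU network of
depth `O(k)` and size `O(2 ^ k)`. -/
theorem exists_isReLUComputable_max (c : ℝ) (k : ℕ) :
    ∀ (ι : Type) [Fintype ι], Fintype.card ι = 2 ^ k →
      ∃ F : (ι → ℝ) → ℝ, IsReLUComputable (2 * k + 1) (9 * 2 ^ k) F ∧
        ∀ x : ι → ℝ, (∀ i, 0 ≤ x i) → ∃ i, F x = x i + c ∧ ∀ j, x j ≤ x i := by
  classical
  induction k with
  | zero =>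
    intro ι _ hι
    refine ⟨_, (IsReLUComputable.output (fun _ => 1) c).mono (by simp) (by simp [hι]),
      fun x _ => ?_⟩
    obtain ⟨i, hi⟩ := Fintype.card_eq_one_iff.1 (hι.trans (pow_zero 2))
    have : Unique ι := ⟨⟨i⟩, hi⟩
    exact ⟨default, by simp, fun j => le_of_eq (congrArg x (Unique.eq_default j))⟩
  | succ k ih =>
    intro ι _ hι
    obtain ⟨F, hF, hmax⟩ := ih (Fin (2 ^ k)) (by simp)
    let e : Fin (2 ^ k) × Bool ≃ ι := Fintype.equivOfCardEq (by simp [hι, pow_succ])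
    -- One round of the tournament: for `b ≥ 0`, `max a b = σ(a - b) + σ(b)`. The inner layer forms
    -- both terms, the outer adds them, and its ReLU is harmless on nonnegative values.
    have key := (hF.hidden (κ := Fin (2 ^ k)) (ι := Fin (2 ^ k) × Bool)
      (fun q p => if p.1 = q then 1 else 0) 0 2 (fun q => by
        refine (Set.ncard_le_ncard (t := {(q, true), (q, false)}) ?_ (Set.toFinite _)).trans
          (Set.ncard_pair (by simp)).le
        rintro ⟨p, b⟩ h
        cases b <;> simp_all)).hidden (ι := ι)
      (fun p i => (if i = e (p.1, true) then 1 else 0) -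
        (if p.2 = true ∧ i = e (p.1, false) then 1 else 0) -
          (if p.2 = false ∧ i = e (p.1, true) then 1 else 0) +
        (if p.2 = false ∧ i = e (p.1, false) then 1 else 0)) 0 2 (fun p => by
        refine (Set.ncard_le_ncard (t := {e (p.1, true), e (p.1, false)}) ?_
          (Set.toFinite _)).trans (Set.ncard_pair (by simp)).le
        intro i h
        by_contra h'
        simp only [Set.mem_insert_iff, Set.mem_singleton_iff, not_or] at h'
        simp [h'.1, h'.2] at h)
    refine ⟨_, key.mono (by omega) ?_, fun x hx => ?_⟩
    -- A round adds `3 * 2 ^ k + 6 * 2 ^ k`, which is why the constant 9 reproduces itself.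
    · simp only [Fintype.card_fin, Fintype.card_prod, Fintype.card_bool, pow_succ]
      omega
    · have hval : (fun q : Fin (2 ^ k) => max (x (e (q, true))) (x (e (q, false)))) =
          fun q : Fin (2 ^ k) => max 0 (∑ p : Fin (2 ^ k) × Bool, (if p.1 = q then 1 else 0) *
            max 0 (∑ i, ((if i = e (p.1, true) then 1 else 0) -
              (if p.2 = true ∧ i = e (p.1, false) then 1 else 0) -
              (if p.2 = false ∧ i = e (p.1, true) then 1 else 0) +
              (if p.2 = false ∧ i = e (p.1, false) then 1 else 0)) * x i +
              (0 : Fin (2 ^ k) × Bool → ℝ) p) + (0 : Fin (2 ^ k) → ℝ) q) := by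
        ext q
        have h1 := hx (e (q, true))
        have h2 := hx (e (q, false))
        simp only [Fintype.sum_prod_type, Fintype.sum_bool, ite_mul, one_mul, zero_mul, add_mul,
          sub_mul, Finset.sum_add_distrib, Finset.sum_sub_distrib]
        simp
        rw [max_eq_right h2]
        grind
      obtain ⟨q, hq, hq'⟩ := hmax
        (fun q => max (x (e (q, true))) (x (e (q, false)))) (fun q => le_max_of_le_left (hx _))
      have hall : ∀ j, x j ≤ max (x (e (q, true))) (x (e (q, false))) := fun j => by
        refine le_trans ?_ (hq' (e.symm j).1)
        obtain ⟨⟨p, b⟩, rfl⟩ := e.surjective j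
        cases b <;> simp
      rw [hval] at hq
      rcases max_choice (x (e (q, true))) (x (e (q, false))) with h | h
      · refine ⟨e (q, true), ?_, h ▸ hall⟩
        exact hq.trans (by rw [h])
      · refine ⟨e (q, false), ?_, h ▸ hall⟩
        exact hq.trans (by rw [h])

/-- A maximum of `2 ^ k` truncated cones `max 0 (v j - K ‖x - p j‖₁)`, shifted by `c`, is computed by
a ReLU network of depth `O(k)` and size `O(2 ^ k)`. -/
theorem exists_isReLUComputable_max_cone (d k : ℕ) {ι : Type} [Fintype ι]
    (hι : Fintype.card ι = 2 ^ k) (p : ι → Fin d → ℝ) (v : ι → ℝ) (K c : ℝ) :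
    ∃ F : (Fin d → ℝ) → ℝ, IsReLUComputable (2 * k + 3) ((6 * d + 10) * 2 ^ k) F ∧
      ∀ x : Fin d → ℝ, ∃ i, F x = max 0 (v i - K * ∑ l, |x l - p i l|) + c ∧
        ∀ j, v j - K * ∑ l, |x l - p j l| ≤ max 0 (v i - K * ∑ l, |x l - p i l|) := by
  classical
  obtain ⟨G, hG, hmax⟩ := exists_isReLUComputable_max c k ι hι
  -- The distances come from `|t| = σ(t) + σ(-t)`, with `2 * d` neurons per cone; the next layer
  -- forms the cones and truncates them at 0.
  have key := (hG.hidden (κ := ι) (ι := ι × (Fin d × Bool))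
    (fun i q => if q.1 = i then -K else 0) v (2 * d) (fun i => by
      refine (Set.ncard_le_ncard (t := (fun a => (i, a)) '' Set.univ) ?_ (Set.toFinite _)).trans
        ((Set.ncard_image_le (Set.toFinite _)).trans ?_)
      · rintro ⟨j, a⟩ h
        simp_all
      · rw [Set.ncard_univ]
        simp [mul_comm])).hidden (ι := Fin d)
    (fun q l => if l = q.2.1 then (if q.2.2 then 1 else -1) else 0)
    (fun q => if q.2.2 then - p q.1 q.2.1 else p q.1 q.2.1) 1 (fun q => by
      refine (Set.ncard_le_ncard (t := {q.2.1}) ?_ (Set.toFinite _)).trans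
        (Set.ncard_singleton _).le
      intro l h
      by_contra h'
      simp_all)
  refine ⟨_, key.mono (by omega) ?_, fun x => ?_⟩
  · simp only [Fintype.card_prod, Fintype.card_bool, Fintype.card_fin, hι]
    exact le_of_eq (by ring)
  · have hval : ∀ i, ∑ q : ι × (Fin d × Bool), (if q.1 = i then -K else 0) *
        max 0 (∑ l, (if l = q.2.1 then (if q.2.2 then (1 : ℝ) else -1) else 0) * x l +
          if q.2.2 then - p q.1 q.2.1 else p q.1 q.2.1) + v i =
        v i - K * ∑ l, |x l - p i l| := fun i => by
      have h : ∀ a b : ℝ, K * |a - b| = K * max 0 (a + -b) + K * max 0 (-a + b) := by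
        intro a b
        rcases le_total a b with h | h
        · rw [abs_of_nonpos (by linarith), max_eq_left (by linarith), max_eq_right (by linarith)]
          ring
        · rw [abs_of_nonneg (by linarith), max_eq_right (by linarith), max_eq_left (by linarith)]
          ring
      simp only [Fintype.sum_prod_type, Fintype.sum_bool]
      simp only [Finset.sum_comm (s := (Finset.univ : Finset ι))]
      simp [Finset.mul_sum, Finset.sum_add_distrib, h]
      ring
    simp only [hval]
    obtain ⟨i, hi, hi'⟩ := hmax (fun i => max 0 (v i - K * ∑ l, |x l - p i l|))
      (fun i => le_max_left _ _)
    exact ⟨i, hi, fun j => (le_max_right _ _).trans (hi' j)⟩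

/-! ### Approximating Lipschitz functions on a cube -/

theorem exists_equispaced_near {n : ℕ} (hn : 0 < n) {R : ℝ} (hR : 0 < R) {t : ℝ} (ht : |t| ≤ R) :
    ∃ j : Fin n, |t - (-R + j * (2 * R / n))| ≤ 2 * R / n := by
  have hn' : (0 : ℝ) < n := by exact_mod_cast hn
  obtain ⟨h, rfl⟩ : ∃ h, R = h * n / 2 := ⟨2 * R / n, by field_simp⟩
  have hh : 0 < h := by
    by_contra hc
    nlinarith
  have hstep : 2 * (h * n / 2) / n = h := by field_simp
  obtain ⟨h1, h2⟩ := abs_le.1 ht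
  have hq : 0 ≤ (t + h * n / 2) / h := div_nonneg (by linarith) hh.le
  have h3 := Nat.floor_le hq
  have h4 := Nat.lt_floor_add_one ((t + h * n / 2) / h)
  rw [le_div_iff₀ hh] at h3
  rw [div_lt_iff₀ hh] at h4
  rw [hstep]
  -- The grid consists of left endpoints, so `t = R` overshoots and takes the last one.
  rcases lt_or_ge ⌊(t + h * n / 2) / h⌋₊ n with hlt | hge
  · refine ⟨⟨_, hlt⟩, abs_le.2 ⟨?_, ?_⟩⟩ <;> simp only <;> nlinarith
  · have hge' : (n : ℝ) ≤ ⌊(t + h * n / 2) / h⌋₊ := by exact_mod_cast hge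
    refine ⟨⟨n - 1, by omega⟩, abs_le.2 ⟨?_, ?_⟩⟩ <;> simp only [Nat.cast_pred hn] <;> nlinarith

/-- A function that is Lipschitz for the `ℓ¹`-norm is approximated on the cube `[-R, R]^d` by a ReLU
network, namely by the maximum of the cones below its graph with vertices on a grid. -/
theorem exists_isReLUComputable_near (d m : ℕ) {R K : ℝ} (hR : 0 < R) (hK : 0 ≤ K)
    (g : (Fin d → ℝ) → ℝ) (hg : ∀ a b, |g a - g b| ≤ K * ∑ l, |a l - b l|) :
    ∃ F : (Fin d → ℝ) → ℝ, IsReLUComputable (2 * (m * d) + 3) ((6 * d + 10) * 2 ^ (m * d)) F ∧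
      ∀ x : Fin d → ℝ, (∀ l, |x l| ≤ R) → |F x - g x| ≤ 2 * (K * (d * (2 * R / 2 ^ m))) := by
  let p : (Fin d → Fin (2 ^ m)) → Fin d → ℝ := fun j l => -R + j l * (2 * R / (2 ^ m : ℕ))
  -- This shift makes `g + B` nonnegative on the cube, so truncation at 0 loses nothing; the output
  -- bias `-B` undoes it.
  set B := |g 0| + K * (d * R) with hB
  obtain ⟨F, hF, hFx⟩ := exists_isReLUComputable_max_cone d (m * d)
    (ι := Fin d → Fin (2 ^ m)) (by simp [pow_mul]) p (fun j => g (p j) + B) K (-B)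
  refine ⟨F, hF, fun x hx => ?_⟩
  obtain ⟨i, hi, hmax⟩ := hFx x
  choose j hj using fun l => exists_equispaced_near (n := 2 ^ m) (by positivity) hR (hx l)
  have hdist : ∑ l, |x l - p j l| ≤ d * (2 * R / 2 ^ m) := by
    refine (Finset.sum_le_card_nsmul _ _ _ fun l _ => hj l).trans (le_of_eq ?_)
    simp
  have hnorm : ∑ l, |x l - (0 : Fin d → ℝ) l| ≤ d * R := by
    refine (Finset.sum_le_card_nsmul _ _ R fun l _ => ?_).trans (le_of_eq ?_)
    · simpa using hx l
    · simp
  have hpos : 0 ≤ g x + B := by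
    have h1 := (abs_le.1 (hg x 0)).1
    have h2 := neg_abs_le (g 0)
    have h3 := mul_le_mul_of_nonneg_left hnorm hK
    linarith
  have hK1 := mul_le_mul_of_nonneg_left hdist hK
  have hlow := hmax j
  have hgj := (abs_le.1 (hg x (p j))).2
  have hgi := (abs_le.1 (hg x (p i))).1
  have hup : max 0 (g (p i) + B - K * ∑ l, |x l - p i l|) ≤ g x + B :=
    max_le hpos (by linarith)
  rw [hi]
  refine abs_le.2 ⟨?_, ?_⟩
  · linarith
  · have : 0 ≤ K * (d * (2 * R / 2 ^ m)) := by positivity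
    linarith

/-! ### Mesh size and constants -/

/-- The ratio between the number `2 ^ m` of grid points in one direction and `2 R / (δ √d)`. -/
noncomputable def gridFactor (d D : ℕ) (K : ℝ≥0) : ℝ := 8 * (K + 1) * d * √D * √d

/-- The constant in the bounds on depth and size. -/
noncomputable def netConst (d D : ℕ) (K : ℝ≥0) : ℝ :=
  4 * (6 * d + 10) * gridFactor d D K ^ d +
    (2 * d * (8 * |Real.log (2 * gridFactor d D K / √D)| + 2) + 12)

theorem gridFactor_nonneg (d D : ℕ) (K : ℝ≥0) : 0 ≤ gridFactor d D K := by
  unfold gridFactor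
  positivity

theorem netConst_pos (d D : ℕ) (K : ℝ≥0) : 0 < netConst d D K := by
  have := gridFactor_nonneg d D K
  unfold netConst
  positivity

/-- The accuracy needs `2 ^ m ≥ 8 K d √D R / δ`. Replacing `K` by `K + 1` keeps the threshold at
least 1 even for `K = 0`; rounding up to a power of two costs at most a factor 2. -/
theorem exists_gridSize {d D : ℕ} (hd : 0 < d) (hD : 0 < D) (K : ℝ≥0) {R δ : ℝ} (hR : 0 < R)
    (hδ : 0 < δ) (h : δ * √d < 2 * R * √D) :
    ∃ m : ℕ, 2 * (K * (d * (2 * R / 2 ^ m))) ≤ δ / (2 * √D) ∧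
      (2 : ℝ) ^ m ≤ gridFactor d D K * (δ * √d / (2 * R))⁻¹ := by
  have hd1 : (1 : ℝ) ≤ d := by exact_mod_cast hd
  have hs1 : 1 ≤ √(d : ℝ) := Real.one_le_sqrt.2 hd1
  have hD0 : 0 < √(D : ℝ) := Real.sqrt_pos.2 (by exact_mod_cast hD)
  have hK : (0 : ℝ) ≤ K := K.2
  have hA : 1 ≤ 8 * (K + 1) * d * √D * R / δ := by
    rw [le_div_iff₀ hδ, one_mul]
    have h1 : δ ≤ 2 * R * √D := by nlinarith
    have h2 : 1 * (2 * R * √D) ≤ (4 * (K + 1) * d) * (2 * R * √D) := by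
      gcongr
      nlinarith
    linarith
  obtain ⟨n, hn1, hn2⟩ := exists_nat_pow_near hA one_lt_two
  refine ⟨n + 1, ?_, ?_⟩
  · rw [div_lt_iff₀ hδ] at hn2
    have h2 : (0 : ℝ) < 2 ^ (n + 1) := by positivity
    have : 2 * (K * (d * (2 * R / 2 ^ (n + 1)))) = 4 * K * d * R / 2 ^ (n + 1) := by ring
    rw [this, div_le_div_iff₀ h2 (by positivity)]
    have : 0 ≤ d * √D * R := by positivity
    nlinarith
  · have : gridFactor d D K * (δ * √d / (2 * R))⁻¹ = 2 * (8 * (K + 1) * d * √D * R / δ) := by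
      unfold gridFactor
      field_simp
    rw [this, pow_succ']
    gcongr

/-- The ratio exceeds 1/2 and `1 - log 2 > 1/4`. The logarithm may be negative, and this bound lets
the bracket absorb additive constants. -/
theorem one_div_four_le_log_add_one {d D : ℕ} (hd : 0 < d) {R δ : ℝ}
    (hδ : 0 < δ) (h : δ * √d < 2 * R * √D) :
    1 / 4 ≤ Real.log (R * √D / (δ * √d)) + 1 := by
  have hd0 : 0 < √(d : ℝ) := Real.sqrt_pos.2 (by exact_mod_cast hd)
  have h1 : 1 / 2 ≤ R * √D / (δ * √d) := by
    rw [div_le_div_iff₀ two_pos (by positivity)]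
    linarith
  have h2 := Real.log_le_log (by norm_num) h1
  rw [one_div, Real.log_inv] at h2
  linarith [Real.log_two_lt_d9]

theorem size_le_netConst {d D : ℕ} (hd : 0 < d) (K : ℝ≥0) {R δ : ℝ} (hR : 0 < R)
    (hδ : 0 < δ) (h : δ * √d < 2 * R * √D) {m : ℕ}
    (hm : (2 : ℝ) ^ m ≤ gridFactor d D K * (δ * √d / (2 * R))⁻¹) :
    (((6 * d + 10) * 2 ^ (m * d) : ℕ) : ℝ) ≤ netConst d D K * (δ * √d / (2 * R)) ^ (-(d : ℤ)) *
      (Real.log (R * √D / (δ * √d)) + 1) := by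
  have hu := one_div_four_le_log_add_one hd hδ h
  have hG := gridFactor_nonneg d D K
  have ht : 0 ≤ δ * √d / (2 * R) := by positivity
  rw [zpow_neg, zpow_natCast, ← inv_pow]
  set t := (δ * √d / (2 * R))⁻¹ with htdef
  have ht' : 0 ≤ t := inv_nonneg.2 ht
  have h1 : ((2 : ℝ) ^ m) ^ d ≤ (gridFactor d D K * t) ^ d := by gcongr
  have h2 : 4 * (6 * d + 10) * gridFactor d D K ^ d ≤ netConst d D K :=
    le_add_of_nonneg_right (by positivity)
  calc (((6 * d + 10) * 2 ^ (m * d) : ℕ) : ℝ) = (6 * d + 10) * ((2 : ℝ) ^ m) ^ d := by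
        push_cast [pow_mul]; ring
    _ ≤ (6 * d + 10) * (gridFactor d D K * t) ^ d := by gcongr
    _ = 4 * (6 * d + 10) * gridFactor d D K ^ d * t ^ d * (1 / 4) := by rw [mul_pow]; ring
    _ ≤ _ := by 
        have := (netConst_pos d D K).le
        gcongr

theorem depth_le_netConst {d D : ℕ} (hd : 0 < d) (hD : 0 < D) (K : ℝ≥0) {R δ : ℝ} (hR : 0 < R)
    (hδ : 0 < δ) (h : δ * √d < 2 * R * √D) {m : ℕ}
    (hm : (2 : ℝ) ^ m ≤ gridFactor d D K * (δ * √d / (2 * R))⁻¹) :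
    ((2 * (m * d) + 3 : ℕ) : ℝ) ≤ netConst d D K * (Real.log (R * √D / (δ * √d)) + 1) := by
  have hu := one_div_four_le_log_add_one hd hδ h
  have hG := gridFactor_nonneg d D K
  have hd0 : 0 < √(d : ℝ) := Real.sqrt_pos.2 (by exact_mod_cast hd)
  have hD0 : 0 < √(D : ℝ) := Real.sqrt_pos.2 (by exact_mod_cast hD)
  have hG0 : 0 < gridFactor d D K := by
    have : (0 : ℝ) < d := by exact_mod_cast hd
    have : (0 : ℝ) ≤ K := K.2
    unfold gridFactor
    positivity
  have hlog := Real.log_le_log (by positivity) hm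
  have hsplit : gridFactor d D K * (δ * √d / (2 * R))⁻¹ =
      (2 * gridFactor d D K / √D) * (R * √D / (δ * √d)) := by
    field_simp
  rw [hsplit, Real.log_mul (by positivity) (by positivity), Real.log_pow] at hlog
  have h2 : 2 * d * (8 * |Real.log (2 * gridFactor d D K / √D)| + 2) + 12 ≤ netConst d D K :=
    le_add_of_nonneg_left (by positivity)
  refine le_trans ?_ (mul_le_mul_of_nonneg_right h2 (by linarith))
  set l := Real.log (2 * gridFactor d D K / √D)
  set u := Real.log (R * √D / (δ * √d)) + 1
  have hl := le_abs_self l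
  have hl0 := abs_nonneg l
  -- `m / 2 ≤ m log 2 ≤ |l| + u`, and `|l| ≤ 4 |l| u` because `u ≥ 1/4`.
  have hm1 : (m : ℝ) ≤ (8 * |l| + 2) * u := by
    have h3 : (m : ℝ) * (1 / 2) ≤ m * Real.log 2 := by
      gcongr
      linarith [Real.log_two_gt_d9]
    nlinarith
  have hm2 := mul_le_mul_of_nonneg_left hm1 (by positivity : (0 : ℝ) ≤ 2 * d)
  push_cast
  nlinarith

/-! ### Encoders and the error decomposition -/

section Encoders

variable {E : Type*} [NormedAddCommGroup E] [InnerProductSpace ℝ E] {w : ℕ → E}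

theorem norm_decoder_sq (hw : Orthonormal ℝ w) (d : ℕ) (a : EuclideanSpace ℝ (Fin d)) :
    ‖decoder w d a‖ ^ 2 = ‖a‖ ^ 2 := by
  rw [decoder, ← real_inner_self_eq_norm_sq, EuclideanSpace.norm_sq_eq]
  refine ((hw.comp _ Fin.val_injective).inner_sum _ _ _).trans ?_
  simp [sq]

theorem norm_decoder_encoder_le (hw : Orthonormal ℝ w) (d : ℕ) (x : E) :
    ‖decoder w d (encoder w d x)‖ ≤ ‖x‖ := by
  refine le_of_sq_le_sq ?_ (norm_nonneg x)
  rw [norm_decoder_sq hw, EuclideanSpace.norm_sq_eq]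
  refine le_trans (le_of_eq ?_)
    ((hw.comp _ (Fin.val_injective (n := d))).sum_inner_products_le x (s := Finset.univ))
  simp [encoder, real_inner_comm]

theorem decoder_sub (d : ℕ) (a b : EuclideanSpace ℝ (Fin d)) :
    decoder w d (a - b) = decoder w d a - decoder w d b := by
  simp [decoder, sub_smul, Finset.sum_sub_distrib]

theorem encoder_sub (d : ℕ) (x y : E) :
    encoder w d (x - y) = encoder w d x - encoder w d y := by
  ext i
  simp [encoder, inner_sub_left]

theorem abs_encoder_le (hw : Orthonormal ℝ w) (d : ℕ) (x : E) (i : Fin d) :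
    |encoder w d x i| ≤ ‖x‖ := by
  refine (abs_real_inner_le_norm x (w i)).trans ?_
  rw [hw.1, mul_one]

theorem norm_decoder_sub_le (hw : Orthonormal ℝ w) (d : ℕ) (a b : EuclideanSpace ℝ (Fin d)) :
    ‖decoder w d a - decoder w d b‖ ≤ ∑ i, |a i - b i| := by
  rw [← decoder_sub]
  refine (norm_sum_le _ _).trans (le_of_eq ?_)
  simp [norm_smul, hw.1]

@[fun_prop]
theorem continuous_decoder_encoder (d : ℕ) :
    Continuous fun x => decoder w d (encoder w d x) := by
  simp only [decoder, encoder]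
  fun_prop

end Encoders

/-- Splitting off `a` first, then separating `b` from `c`, gives the uneven weights of the final
bound. -/
theorem norm_add_add_sq_le {E : Type*} [SeminormedAddCommGroup E] (a b c : E) :
    ‖a + b + c‖ ^ 2 ≤ 2 * ‖a‖ ^ 2 + 4 * ‖b‖ ^ 2 + 4 * ‖c‖ ^ 2 := by
  have h := norm_add₃_le (a := a) (b := b) (c := c)
  have h0 := norm_nonneg (a + b + c)
  nlinarith [sq_nonneg (‖a‖ - (‖b‖ + ‖c‖)), sq_nonneg (‖b‖ - ‖c‖)]

/-- The error of an encoder-network-decoder chain is at most the network error plus the two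
projection errors. -/
theorem norm_decoder_sub_sq_le {H Y : Type*} [NormedAddCommGroup H] [InnerProductSpace ℝ H]
    [NormedAddCommGroup Y] [InnerProductSpace ℝ Y] {wH : ℕ → H} {wY : ℕ → Y}
    (hY : Orthonormal ℝ wY) {K : ℝ≥0} {Ψ : H → Y} (hΨ : LipschitzWith K Ψ) (dH dY : ℕ)
    (b : EuclideanSpace ℝ (Fin dY)) (x : H) :
    ‖decoder wY dY b - Ψ x‖ ^ 2 ≤
      2 * ‖b - encoder wY dY (Ψ (decoder wH dH (encoder wH dH x)))‖ ^ 2 +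
        4 * ((K : ℝ) ^ 2 * ‖x - decoder wH dH (encoder wH dH x)‖ ^ 2) +
        4 * ‖Ψ x - decoder wY dY (encoder wY dY (Ψ x))‖ ^ 2 := by
  set z := decoder wH dH (encoder wH dH x)
  have h1 : decoder wY dY b - Ψ x = decoder wY dY (b - encoder wY dY (Ψ z)) +
      decoder wY dY (encoder wY dY (Ψ z - Ψ x)) +
      (decoder wY dY (encoder wY dY (Ψ x)) - Ψ x) := by
    rw [encoder_sub, decoder_sub, decoder_sub]
    abel
  have h2 : ‖decoder wY dY (encoder wY dY (Ψ z - Ψ x))‖ ≤ K * ‖x - z‖ := by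
    refine (norm_decoder_encoder_le hY dY _).trans ?_
    rw [norm_sub_rev x z]
    exact hΨ.norm_sub_le z x
  have h3 := pow_le_pow_left₀ (norm_nonneg _) h2 2
  rw [mul_pow] at h3
  rw [h1, ← norm_decoder_sq hY, norm_sub_rev (Ψ x)]
  refine (norm_add_add_sq_le _ _ _).trans ?_
  gcongr

/-- A continuous function is integrable on a compact set carrying a finite measure. The map `Φ`
covers both the identity and `Ψ`. -/
theorem integrable_projError {E : Type*} [NormedAddCommGroup E] [InnerProductSpace ℝ E]
    [MeasurableSpace E] [BorelSpace E] [SecondCountableTopology E] {X : Type*}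
    [TopologicalSpace X] [MeasurableSpace X] [OpensMeasurableSpace X] [T2Space X]
    {μ : Measure X} [IsFiniteMeasure μ] {S : Set X} (hS : IsCompact S) (hμ : ∀ᵐ x ∂μ, x ∈ S)
    {Φ : X → E} (hΦ : Continuous Φ) (w : ℕ → E) (d : ℕ) :
    Integrable (fun x => ‖Φ x - decoder w d (encoder w d (Φ x))‖ ^ 2) μ := by
  have hc : Continuous fun x => ‖Φ x - decoder w d (encoder w d (Φ x))‖ ^ 2 :=
    ((hΦ.sub ((continuous_decoder_encoder d).comp hΦ)).norm).pow 2
  rw [← Measure.restrict_eq_self_of_ae_mem hμ]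
  exact hc.continuousOn.integrableOn_compact' hS hS.measurableSet

theorem isReLUMap_domRestrict_mem {n n' L r : ℕ}
    {Γ : EuclideanSpace ℝ (Fin n) → EuclideanSpace ℝ (Fin n')} (h : IsReLUMap n n' L r Γ) (M : ℝ) :
    (cube n M).domRestrict Γ ∈ FNN n n' L r M := fun k => by
  obtain ⟨f, h1, h2, h3⟩ := h k
  exact ⟨f, h1, h2, fun x => h3 x⟩

/-! ### Assembling the network and the error bound -/

/-- A Lipschitz map between Hilbert spaces, encoded, is approximated on a ball by a ReLU map. -/
theorem exists_isReLUMap_near {H Y : Type*} [NormedAddCommGroup H] [InnerProductSpace ℝ H]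
    [NormedAddCommGroup Y] [InnerProductSpace ℝ Y] {wH : ℕ → H} (hH : Orthonormal ℝ wH)
    {wY : ℕ → Y} (hY : Orthonormal ℝ wY) {K : ℝ≥0} {Ψ : H → Y} (hΨ : LipschitzWith K Ψ)
    {R : ℝ} (hR : 0 < R) (dH dY m : ℕ) :
    ∃ Γ : EuclideanSpace ℝ (Fin dH) → EuclideanSpace ℝ (Fin dY),
      IsReLUMap dH dY (2 * (m * dH) + 3) ((6 * dH + 10) * 2 ^ (m * dH)) Γ ∧
      ∀ x : H, ‖x‖ ≤ R →
        ∀ k, |Γ (encoder wH dH x) k - encoder wY dY (Ψ (decoder wH dH (encoder wH dH x))) k| ≤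
          2 * (K * (dH * (2 * R / 2 ^ m))) := by
  -- The decoder is 1-Lipschitz from ℓ¹, and each encoder coordinate is 1-Lipschitz by
  -- Cauchy–Schwarz.
  have key : ∀ k : Fin dY, ∃ F : (Fin dH → ℝ) → ℝ, _ ∧ _ := fun k =>
    exists_isReLUComputable_near dH m hR K.2
      (fun a => encoder wY dY (Ψ (decoder wH dH (WithLp.toLp 2 a))) k) (fun a b => by
        rw [← PiLp.sub_apply, ← encoder_sub]
        refine (abs_encoder_le hY _ _ _).trans ((hΨ.norm_sub_le _ _).trans ?_)
        exact mul_le_mul_of_nonneg_left (norm_decoder_sub_le hH _ _ _) K.2)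
  choose F hF hFx using key
  refine ⟨fun a => WithLp.toLp 2 fun k => F k a.ofLp, fun k => ?_, fun x hx k => ?_⟩
  · have hk := hF k
    unfold IsReLUComputable at hk
    rw [Fintype.card_fin] at hk
    obtain ⟨f, h1, h2, h3⟩ := hk (Equiv.refl _)
    exact ⟨f, h1, h2, fun x => (h3 x.ofLp).symm⟩
  · exact hFx k (encoder wH dH x).ofLp fun l => (abs_encoder_le hH dH x l).trans hx

theorem norm_sq_le_of_abs_le {n : ℕ} (hn : 0 < n) {ε : ℝ} (a : EuclideanSpace ℝ (Fin n))
    (h : ∀ k, |a k| ≤ ε / (2 * √n)) : ‖a‖ ^ 2 ≤ ε ^ 2 / 4 := by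
  have hn' : (0 : ℝ) < n := by exact_mod_cast hn
  rw [EuclideanSpace.norm_sq_eq]
  refine (Finset.sum_le_card_nsmul _ _ _ fun k _ =>
    pow_le_pow_left₀ (norm_nonneg _) (h k) 2).trans (le_of_eq ?_)
  rw [div_pow, mul_pow, Real.sq_sqrt hn'.le]
  simp
  field_simp
  norm_num

theorem mainTheorem5 :
    ∃ c : ℕ → ℕ → ℝ≥0 → ℝ, (∀ dH dY LΨ, 0 < c dH dY LΨ) ∧
      ∀ (H : Type*) [NormedAddCommGroup H] [InnerProductSpace ℝ H] [CompleteSpace H]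
        [TopologicalSpace.SeparableSpace H] [MeasurableSpace H] [BorelSpace H]
        (Y : Type*) [NormedAddCommGroup Y] [InnerProductSpace ℝ Y] [CompleteSpace Y]
        [TopologicalSpace.SeparableSpace Y] [MeasurableSpace Y] [BorelSpace Y]
        (wH : ℕ → H) (_ : Orthonormal ℝ wH) (wY : ℕ → Y) (_ : Orthonormal ℝ wY)
        (R : ℝ) (_ : 0 < R)
        (P : Measure H) [IsProbabilityMeasure P]
        (_ : IsCompact P.support) (_ : P.support ⊆ Metric.closedBall 0 R)
        (LΨ : ℝ≥0) (Ψ : H → Y) (_ : LipschitzWith LΨ Ψ),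
        ∃ QH QY : ℝ, 0 ≤ QH ∧ 0 ≤ QY ∧
          ∀ (dH dY N : ℕ) (_ : 0 < dH) (_ : 0 < dY) (_ : 0 < N)
            (δ : ℝ) (_ : 0 < δ) (_ : δ * √dH < 2 * R * √dY),
            ∃ (L r : ℕ) (Γ : EuclideanSpace ℝ (Fin dH) → EuclideanSpace ℝ (Fin dY)),
              IsReLUMap dH dY L r Γ ∧
              (cube dH (R / √dH)).domRestrict Γ ∈ FNN dH dY L r (R / √dH) ∧
              (L : ℝ) ≤ c dH dY LΨ * (Real.log (R * √dY / (δ * √dH)) + 1) ∧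
              (r : ℝ) ≤ c dH dY LΨ * (δ * √dH / (2 * R)) ^ (-(dH : ℤ)) *
                (Real.log (R * √dY / (δ * √dH)) + 1) ∧
              (∫ _s : Fin N → H,
                  (∫ x, ‖decoder wY dY (Γ (encoder wH dH x)) - Ψ x‖ ^ 2 ∂P)
                    ∂(Measure.pi fun _ => P)) <
                2 * δ ^ 2
                  + 4 * (LΨ : ℝ) ^ 2 * (√(QH * dH / N) + projError wH dH P)
                  + 4 * (√(QY * dY / N) + projError wY dY (P.map Ψ)) := by
  refine ⟨netConst, netConst_pos, ?_⟩
  intro H _ _ _ _ _ _ Y _ _ _ _ _ _ wH hH wY hY R hR P _ hS hSR K Ψ hΨ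
  -- The encoders do not depend on the sample, so no sampling error arises.
  refine ⟨0, 0, le_rfl, le_rfl, fun dH dY N hdH hdY _ δ hδ hδR => ?_⟩
  have : SecondCountableTopology H := UniformSpace.secondCountable_of_separable H
  have : SecondCountableTopology Y := UniformSpace.secondCountable_of_separable Y
  obtain ⟨m, hm1, hm2⟩ := exists_gridSize hdH hdY K hR hδ hδR
  obtain ⟨Γ, hΓ, hΓx⟩ := exists_isReLUMap_near hH hY hΨ hR dH dY m
  refine ⟨_, _, Γ, hΓ, isReLUMap_domRestrict_mem hΓ _, depth_le_netConst hdH hdY K hR hδ hδR hm2,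
    size_le_netConst hdH K hR hδ hδR hm2, ?_⟩
  have hae : ∀ᵐ x ∂P, x ∈ P.support := Measure.support_mem_ae
  have hiH := integrable_projError hS hae continuous_id wH dH
  have hiY := integrable_projError hS hae hΨ.continuous wY dY
  simp only [id] at hiH
  have hmapY : projError wY dY (P.map Ψ) =
      ∫ x, ‖Ψ x - decoder wY dY (encoder wY dY (Ψ x))‖ ^ 2 ∂P := by
    refine integral_map hΨ.continuous.aemeasurable (Continuous.aestronglyMeasurable ?_)
    fun_prop
  have hsum : Integrable (fun x => 2 * (δ ^ 2 / 4) +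
      4 * ((K : ℝ) ^ 2 * ‖x - decoder wH dH (encoder wH dH x)‖ ^ 2)) P :=
    (integrable_const _).add ((hiH.const_mul _).const_mul _)
  have hle : ∫ x, ‖decoder wY dY (Γ (encoder wH dH x)) - Ψ x‖ ^ 2 ∂P ≤
      ∫ x, (2 * (δ ^ 2 / 4) +
        4 * ((K : ℝ) ^ 2 * ‖x - decoder wH dH (encoder wH dH x)‖ ^ 2) +
        4 * ‖Ψ x - decoder wY dY (encoder wY dY (Ψ x))‖ ^ 2) ∂P := by
    refine integral_mono_of_nonneg (.of_forall fun x => by positivity)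
      (hsum.add (hiY.const_mul _)) ?_
    filter_upwards [hae] with x hx
    have hxR : ‖x‖ ≤ R := by simpa using hSR hx
    refine (norm_decoder_sub_sq_le (wH := wH) hY hΨ dH dY _ x).trans ?_
    gcongr
    exact norm_sq_le_of_abs_le hdY _ fun k => (hΓx x hxR k).trans hm1
  rw [integral_add hsum (hiY.const_mul _),
    integral_add (integrable_const _) ((hiH.const_mul _).const_mul _), integral_const_mul,
    integral_const_mul, integral_const_mul, integral_const_mul, ← hmapY] at hle
  change _ ≤ _ + 4 * (_ * projError wH dH P) + _ at hle
  rw [integral_const, probReal_univ, one_smul] at hle ⊢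
  simp only [zero_mul, zero_div, Real.sqrt_zero, zero_add]
  -- The network contributes only `δ ^ 2 / 2`, hence the strict inequality.
  nlinarith [sq_pos_of_pos hδ]
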